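/- Let $\mathbb{K}$ be either the real or the complex scalar field. For a locally compact Hausdorff space $K$, let $C_0(K)$ be the Banach space of continuous functions $K\to\mathbb{K}$ vanishing at infinity, with the supremum norm, and let $c_0$ be the Banach space of sequences in $\mathbb{K}$ converging to zero, with the supremum norm. For normed spaces $X$ and $Z$ over $\mathbb{K}$, let $\mathscr{B}(X,Z)$ denote the space of bounded linear operators from $X$ to $Z$, with the operator norm. **Theorem.** Let $K$ be a locally compact Hausdorff space, let $Y$ be a Banach space over $\mathbb{K}$ such that the closed unit ball of the dual space $Y^*$ is weak* sequentially compact, let $T\in\mathscr{B}(C_0(K),Y)$, and let $C>0$. Then $C_0(K)$ contains a sequence $(f_n)_{n\in\mathbb{N}}$ such that $$\sup_{k\in K}\sum_{n=1}^\infty |f_n(k)|\le 1\qquad\text{and}\qquad \inf_{n\in\mathbb{N}}\|Tf_n\|>\frac1C$$ if and only if there are operators $U\in\mathscr{B}(Y,c_0)$ and $V\in\mathscr{B}(c_0,C_0(K))$ such that $$UTV=I_{c_0}\qquad\text{and}\qquad \|U\|\,\|V\|<C,$$ where $I_{c_0}$ is the identity operator on $c_0$. (The supremum is taken in $[0,\infty]$;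 it is $0$ if $K$ is empty.) -/

import Mathlib

open scoped ZeroAtInfty

/-- The Banach space `c₀` of scalar sequences converging to zero, with the supremum norm:
continuous functions on the discrete space `ℕ` that vanish at infinity. -/
abbrev CZero (𝕜 : Type*) [RCLike 𝕜] : Type _ := C₀(ℕ, 𝕜)

/-- The closed unit ball of the dual of `Y` is weak* sequentially compact. -/
def DualBallWeakStarSeqCompact (𝕜 Y : Type*) [RCLike 𝕜] [NormedAddCommGroup Y]
    [NormedSpace 𝕜 Y] : Prop :=
  IsSeqCompact {φ : WeakDual 𝕜 Y | ‖WeakDual.toStrongDual φ‖ ≤ 1}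

/-!
A bounded operator `V` from `c₀` into a Banach space is the same as a weakly unconditionally
Cauchy series `∑ V eₙ`, and in `C₀(K)` such a series with constant one is a sequence with
`∑ |fₙ(k)| ≤ 1` at every point `k`. If `U T V = I`, then `fₙ = V eₙ / ‖V‖` is the required
sequence.

Conversely, let `δ = inf ‖T fₙ‖` and choose `gₙ` in the dual unit ball with `gₙ (T fₙ) = δ`. Weak*
sequential compactness makes `gₙ` weak* convergent along a subsequence, and since `T fₙ` is weakly
null a further subsequence makes the matrix `gᵢ (T fⱼ)` as close to `δ I` as desired. The
functionals `(g₂ₙ - g₂ₙ₊₁) / 2` are weak* null, so they define a contraction `U` into `c₀`, while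
`f₂ₙ - f₂ₙ₊₁` defines a contraction `V` from `c₀`. Then `U T V` is a small perturbation of `δ I`,
and composing `U` with a left inverse of it costs a factor close to `1 / δ`.
-/

open Filter Topology

section WeaklyUnconditionallyCauchy

variable {𝕜 ι κ X Z : Type*} [RCLike 𝕜] [NormedAddCommGroup X] [NormedSpace 𝕜 X]
  [NormedAddCommGroup Z] [NormedSpace 𝕜 Z] {M : ℝ}

/-- The series `∑ i, x i` is weakly unconditionally Cauchy with constant `M`. By Hahn-Banach this
says that `∑ i, ‖φ (x i)‖ ≤ M` for all `φ` in the unit ball of the dual; the encoding by finite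
sums avoids the dual. -/
def HasWUCBound (𝕜 : Type*) [RCLike 𝕜] [NormedSpace 𝕜 X] (x : ι → X) (M : ℝ) : Prop :=
  ∀ (t : Finset ι) (c : ι → 𝕜), (∀ i ∈ t, ‖c i‖ ≤ 1) → ‖∑ i ∈ t, c i • x i‖ ≤ M

namespace HasWUCBound

variable {x : ι → X}

theorem nonneg (hx : HasWUCBound 𝕜 x M) : 0 ≤ M := by
  simpa using hx ∅ 0

theorem norm_sum_smul_le (hx : HasWUCBound 𝕜 x M) {t : Finset ι} {c : ι → 𝕜} {r : ℝ}
    (hr : 0 ≤ r) (hc : ∀ i ∈ t, ‖c i‖ ≤ r) : ‖∑ i ∈ t, c i • x i‖ ≤ r * M := by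
  rcases hr.eq_or_lt with rfl | hr
  · have hc0 : ∀ i ∈ t, c i • x i = 0 := fun i hi => by
      rw [norm_le_zero_iff.1 (hc i hi), zero_smul]
    simp [Finset.sum_eq_zero hc0]
  · have hr0 : (r : 𝕜) ≠ 0 := by simpa using hr.ne'
    have hsum : ∑ i ∈ t, c i • x i = (r : 𝕜) • ∑ i ∈ t, ((r : 𝕜)⁻¹ * c i) • x i := by
      simp only [Finset.smul_sum, smul_smul, mul_inv_cancel_left₀ hr0]
    rw [hsum, norm_smul, RCLike.norm_of_nonneg hr.le]
    gcongr
    refine hx t _ fun i hi => ?_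
    rw [norm_mul, norm_inv, RCLike.norm_of_nonneg hr.le, inv_mul_le_one₀ hr]
    exact hc i hi

theorem map (hx : HasWUCBound 𝕜 x M) (T : X →L[𝕜] Z) :
    HasWUCBound 𝕜 (fun i => T (x i)) (‖T‖ * M) := fun t c hc => by
  simpa using T.le_opNorm_of_le (hx t c hc)

theorem const_smul (hx : HasWUCBound 𝕜 x M) (a : 𝕜) :
    HasWUCBound 𝕜 (fun i => a • x i) (‖a‖ * M) := fun t c hc => by
  simp only [smul_comm _ a, ← Finset.smul_sum, norm_smul]
  gcongr
  exact hx t c hc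

theorem comp_injective (hx : HasWUCBound 𝕜 x M) {f : κ → ι} (hf : f.Injective) :
    HasWUCBound 𝕜 (fun k => x (f k)) M := fun t c hc => by
  have hext : ∀ k, f.extend c 0 (f k) = c k := hf.extend_apply c 0
  simpa [hext] using hx (t.map ⟨f, hf⟩) (f.extend c 0) (by simpa [hext] using hc)

theorem sub_of_sumElim {x y : ι → X} (h : HasWUCBound 𝕜 (Sum.elim x y) M) :
    HasWUCBound 𝕜 (fun i => x i - y i) M := fun t c hc => by
  simpa [Finset.sum_disjSum, smul_sub, ← sub_eq_add_neg] using
    h (t.disjSum t) (Sum.elim c (-c)) (by simpa using hc)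

theorem even_sub_odd {x : ℕ → X} (hx : HasWUCBound 𝕜 x M) :
    HasWUCBound 𝕜 (fun j => x (2 * j) - x (2 * j + 1)) M := by
  refine sub_of_sumElim ?_
  convert hx.comp_injective Equiv.natSumNatEquivNat.injective using 1
  ext (j | j) <;> simp

theorem summable_smul [CompleteSpace X] (hx : HasWUCBound 𝕜 x M) {c : ι → 𝕜}
    (hc : Tendsto c cofinite (𝓝 0)) : Summable fun i => c i • x i := by
  rw [summable_iff_vanishing_norm]
  intro ε hε
  obtain ⟨r, hr, hrε⟩ := exists_pos_mul_lt hε M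
  have hfin : {i | ¬ ‖c i‖ < r}.Finite :=
    (tendsto_zero_iff_norm_tendsto_zero.1 hc).eventually_lt_const hr
  refine ⟨hfin.toFinset, fun t ht => ?_⟩
  have hct : ∀ i ∈ t, ‖c i‖ ≤ r := fun i hi =>
    le_of_lt <| by simpa using Finset.disjoint_left.1 ht hi
  calc ‖∑ i ∈ t, c i • x i‖ ≤ r * M := hx.norm_sum_smul_le hr.le hct
    _ = M * r := mul_comm _ _
    _ < ε := hrε

end HasWUCBound

theorem hasWUCBound_scalar_iff {a : ι → 𝕜} :
    HasWUCBound 𝕜 a M ↔ ∀ t : Finset ι, ∑ i ∈ t, ‖a i‖ ≤ M := by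
  refine ⟨fun h t => ?_, fun h t c hc => ?_⟩
  · choose c hc hca using fun i => RCLike.exists_norm_eq_mul_self (a i)
    calc ∑ i ∈ t, ‖a i‖ = ‖((∑ i ∈ t, ‖a i‖ : ℝ) : 𝕜)‖ :=
          (RCLike.norm_of_nonneg (by positivity)).symm
      _ = ‖∑ i ∈ t, c i • a i‖ := by simp [hca]
      _ ≤ M := h t c fun i _ => (hc i).le
  · refine (norm_sum_le_of_le t fun i hi => ?_).trans (h t)
    rw [norm_smul]
    exact mul_le_of_le_one_left (norm_nonneg _) (hc i hi)

theorem HasWUCBound.tendsto_apply_zero {x : ι → X} (hx : HasWUCBound 𝕜 x M)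
    (φ : StrongDual 𝕜 X) : Tendsto (fun i => φ (x i)) cofinite (𝓝 0) :=
  tendsto_zero_iff_norm_tendsto_zero.2 <|
    (summable_of_sum_le (fun _ => norm_nonneg _)
      (hasWUCBound_scalar_iff.1 (hx.map φ))).tendsto_cofinite_zero

end WeaklyUnconditionallyCauchy

section ZeroAtInfty

variable {𝕜 K ι : Type*} [RCLike 𝕜] [TopologicalSpace K]

theorem zeroAtInfty_norm_le_iff {E : Type*} [NormedAddCommGroup E] {f : C₀(K, E)} {M : ℝ}
    (hM : 0 ≤ M) : ‖f‖ ≤ M ↔ ∀ k, ‖f k‖ ≤ M := by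
  rw [← ZeroAtInftyContinuousMap.norm_toBCF_eq_norm]
  exact BoundedContinuousFunction.norm_le hM

theorem zeroAtInfty_norm_apply_le {E : Type*} [NormedAddCommGroup E] (f : C₀(K, E)) (k : K) :
    ‖f k‖ ≤ ‖f‖ :=
  (zeroAtInfty_norm_le_iff (norm_nonneg f)).1 le_rfl k

/-- Evaluation at a point of `K`, as a bounded operator on `C₀(K, 𝕜)`. -/
noncomputable def zeroAtInftyEval (𝕜 : Type*) [RCLike 𝕜] (k : K) : C₀(K, 𝕜) →L[𝕜] 𝕜 :=
  LinearMap.mkContinuous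
    { toFun := fun f => f k
      map_add' := fun _ _ => rfl
      map_smul' := fun _ _ => rfl }
    1 fun f => by
      rw [one_mul]
      exact zeroAtInfty_norm_apply_le f k

theorem zeroAtInftyEval_apply (k : K) (f : C₀(K, 𝕜)) : zeroAtInftyEval 𝕜 k f = f k :=
  rfl

theorem hasWUCBound_zeroAtInfty_iff {f : ι → C₀(K, 𝕜)} {M : ℝ} (hM : 0 ≤ M) :
    HasWUCBound 𝕜 f M ↔ ∀ (k : K) (t : Finset ι), ∑ i ∈ t, ‖f i k‖ ≤ M := by
  have hsum : ∀ (t : Finset ι) (c : ι → 𝕜) (k : K),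
      (∑ i ∈ t, c i • f i) k = ∑ i ∈ t, c i • f i k := fun t c k => by
    simp only [← zeroAtInftyEval_apply, map_sum, map_smul]
  simp only [← hasWUCBound_scalar_iff (𝕜 := 𝕜), HasWUCBound, zeroAtInfty_norm_le_iff hM, hsum]
  exact ⟨fun h k t c hc => h t c hc k, fun h t c hc k => h k t c hc⟩

theorem hasWUCBound_zeroAtInfty_iff_iSup_tsum_enorm_le {f : ι → C₀(K, 𝕜)} {M : ℝ} (hM : 0 ≤ M) :
    HasWUCBound 𝕜 f M ↔ ⨆ k, ∑' i, ‖f i k‖ₑ ≤ ENNReal.ofReal M := by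
  simp only [hasWUCBound_zeroAtInfty_iff hM, iSup_le_iff, ENNReal.tsum_eq_iSup_sum,
    ← ofReal_norm, ← ENNReal.ofReal_sum_of_nonneg fun _ _ => norm_nonneg _,
    ENNReal.ofReal_le_ofReal_iff hM]

end ZeroAtInfty

namespace CZero

variable {𝕜 X Y : Type*} [RCLike 𝕜] [NormedAddCommGroup X] [NormedSpace 𝕜 X]
  [NormedAddCommGroup Y] [NormedSpace 𝕜 Y]

theorem tendsto_cofinite_zero (x : CZero 𝕜) : Tendsto x cofinite (𝓝 0) := by
  simpa only [cocompact_eq_cofinite] using zero_at_infty x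

/-- A null sequence, as an element of `c₀`. -/
def ofTendsto (x : ℕ → 𝕜) (hx : Tendsto x atTop (𝓝 0)) : CZero 𝕜 where
  toFun := x
  continuous_toFun := continuous_of_discreteTopology
  zero_at_infty' := by rwa [cocompact_eq_cofinite, Nat.cofinite_eq_atTop]

/-- The `n`-th unit vector of `c₀`. -/
noncomputable def single (𝕜 : Type*) [RCLike 𝕜] (n : ℕ) : CZero 𝕜 :=
  ofTendsto (Pi.single n 1) <| tendsto_const_nhds.congr' <| by
    filter_upwards [eventually_gt_atTop n] with m hm
    simp [hm.ne']

theorem single_apply (n m : ℕ) : single 𝕜 n m = if m = n then 1 else 0 :=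
  Pi.single_apply n 1 m

theorem norm_single (n : ℕ) : ‖single 𝕜 n‖ = 1 := by
  refine le_antisymm ((zeroAtInfty_norm_le_iff zero_le_one).2 fun m => ?_) ?_
  · rw [single_apply]
    split_ifs <;> simp
  · simpa [single_apply] using zeroAtInfty_norm_apply_le (single 𝕜 n) n

instance : Nontrivial (CZero 𝕜) :=
  ⟨single 𝕜 0, 0, fun h => by simpa [h] using norm_single (𝕜 := 𝕜) 0⟩

theorem hasWUCBound_single : HasWUCBound 𝕜 (single 𝕜) 1 := by
  rw [hasWUCBound_zeroAtInfty_iff zero_le_one]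
  intro m t
  simp only [single_apply, apply_ite norm, norm_one, norm_zero, Finset.sum_ite_eq]
  split_ifs <;> simp

theorem hasSum_smul_single (x : CZero 𝕜) : HasSum (fun n => x n • single 𝕜 n) x := by
  obtain ⟨y, hy⟩ := hasWUCBound_single.summable_smul x.tendsto_cofinite_zero
  suffices y = x by rwa [this] at hy
  ext m
  have hym : HasSum (fun n => x n • single 𝕜 n m) (y m) := by
    simpa only [map_smul, zeroAtInftyEval_apply] using hy.mapL (zeroAtInftyEval 𝕜 m)
  refine hym.unique ?_
  convert hasSum_single m fun n hn => ?_ using 1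
  · simp [single_apply]
  · simp [single_apply, hn.symm]

theorem opNorm_le_of_norm_apply_single_le {E : CZero 𝕜 →L[𝕜] X} {a : ℕ → ℝ} {ε : ℝ}
    (ha : HasSum a ε) (hE : ∀ n, ‖E (single 𝕜 n)‖ ≤ a n) : ‖E‖ ≤ ε := by
  refine E.opNorm_le_bound (ha.nonneg fun n => (norm_nonneg _).trans (hE n)) fun x => ?_
  rw [← (x.hasSum_smul_single.mapL E).tsum_eq]
  refine tsum_of_norm_bounded (ha.mul_right ‖x‖) fun n => ?_
  rw [map_smul, norm_smul, mul_comm]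
  gcongr
  · exact (norm_nonneg _).trans (hE n)
  · exact hE n
  · exact zeroAtInfty_norm_apply_le x n

theorem exists_clm_apply_single_eq [CompleteSpace X] {x : ℕ → X} {M : ℝ}
    (hx : HasWUCBound 𝕜 x M) :
    ∃ V : CZero 𝕜 →L[𝕜] X, ‖V‖ ≤ M ∧ ∀ n, V (single 𝕜 n) = x n := by
  have hs : ∀ c : CZero 𝕜, Summable fun n => c n • x n := fun c =>
    hx.summable_smul c.tendsto_cofinite_zero
  let L : CZero 𝕜 →ₗ[𝕜] X :=
    { toFun := fun c => ∑' n, c n • x n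
      map_add' := fun c d => by
        rw [← (hs c).tsum_add (hs d)]
        simp [add_smul]
      map_smul' := fun r c => by
        rw [RingHom.id_apply, ← (hs c).tsum_const_smul]
        simp [mul_smul] }
  have hL : ∀ c, ‖L c‖ ≤ M * ‖c‖ := fun c => by
    refine le_of_tendsto (hs c).hasSum.norm (Eventually.of_forall fun t => ?_)
    rw [mul_comm]
    exact hx.norm_sum_smul_le (norm_nonneg c) fun n _ => zeroAtInfty_norm_apply_le c n
  refine ⟨L.mkContinuous M hL, L.mkContinuous_norm_le hx.nonneg hL, fun n => ?_⟩
  change ∑' m, single 𝕜 n m • x m = x n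
  simp [single_apply]

theorem exists_clm_coord_eq {u : ℕ → StrongDual 𝕜 Y} {M : ℝ} (hu : ∀ n, ‖u n‖ ≤ M)
    (hu0 : ∀ y, Tendsto (fun n => u n y) atTop (𝓝 0)) :
    ∃ U : Y →L[𝕜] CZero 𝕜, ‖U‖ ≤ M ∧ ∀ y n, U y n = u n y := by
  have hM : 0 ≤ M := (norm_nonneg _).trans (hu 0)
  let L : Y →ₗ[𝕜] CZero 𝕜 :=
    { toFun := fun y => ofTendsto (fun n => u n y) (hu0 y)
      map_add' := fun y z => by ext n; exact map_add (u n) y z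
      map_smul' := fun c y => by ext n; exact map_smul (u n) c y }
  have hL : ∀ y, ‖L y‖ ≤ M * ‖y‖ := fun y =>
    (zeroAtInfty_norm_le_iff (by positivity)).2 fun n => (u n).le_of_opNorm_le (hu n) y
  exact ⟨L.mkContinuous M hL, L.mkContinuous_norm_le hM hL, fun _ _ => rfl⟩

end CZero

theorem exists_leftInverse_norm_le_of_norm_smul_one_sub_le {𝕜 A : Type*} [NormedField 𝕜]
    [NormedRing A] [NormOneClass A] [NormedAlgebra 𝕜 A] [CompleteSpace A] {c : 𝕜} {s : A} {ε : ℝ}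
    (hs : ‖c • (1 : A) - s‖ ≤ ε) (hε : ε < ‖c‖) :
    ∃ r : A, r * s = 1 ∧ ‖r‖ ≤ (‖c‖ - ε)⁻¹ := by
  have hc : c ≠ 0 := norm_pos_iff.1 <| (norm_nonneg _).trans_lt (hs.trans_lt hε)
  have hnear : ‖s - algebraMap 𝕜 A c‖ < ‖algebraMap 𝕜 A c⁻¹‖⁻¹ := by
    rw [norm_sub_rev, norm_algebraMap', norm_inv, inv_inv, Algebra.algebraMap_eq_smul_one]
    exact hs.trans_lt hε
  obtain ⟨r, hsr, hrs⟩ : ∃ r, s * r = 1 ∧ r * s = 1 := isUnit_iff_exists.1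
    (((Units.mk0 c hc).map (algebraMap 𝕜 A).toMonoidHom).ofNearby s hnear).isUnit
  refine ⟨r, hrs, ?_⟩
  have hsplit : c • r = 1 + (c • 1 - s) * r := by
    rw [sub_mul, hsr, smul_one_mul, add_sub_cancel]
  have hbound : ‖c‖ * ‖r‖ ≤ 1 + ε * ‖r‖ := by
    rw [← norm_smul, hsplit]
    refine (norm_add_le _ _).trans ?_
    rw [norm_one]
    gcongr
    exact (norm_mul_le _ _).trans (by gcongr)
  rw [← one_div, le_div_iff₀ (sub_pos.2 hε)]
  linarith

theorem exists_strictMono_offDiag_le {a : ℕ → ℕ → ℝ} {b η : ℕ → ℝ}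
    (hη : ∀ n, 0 < η n) (hanti : Antitone η)
    (hrow : ∀ i, Tendsto (fun j => a i j) atTop (𝓝 0))
    (hcol : ∀ j, Tendsto (fun i => a i j) atTop (𝓝 (b j))) (hb : Tendsto b atTop (𝓝 0)) :
    ∃ φ : ℕ → ℕ, StrictMono φ ∧ ∀ i j, i ≠ j → a (φ i) (φ j) ≤ η j := by
  -- A pair `(N, m)` selects the index `m` with error allowance `η N`, where `N` is a lower bound
  -- for the position of `m` in the subsequence.
  obtain ⟨p, -, hp⟩ := exists_seq_of_forall_finset_exists
    (fun p : ℕ × ℕ => b p.2 < η p.1)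
    (fun p q => (p.1 < q.1 ∧ p.2 < q.2) ∧ a p.2 q.2 < η q.1 ∧ a q.2 p.2 < η p.1) fun s hs => by
      obtain ⟨N, hN⟩ : ∃ N, ∀ p ∈ s, p.1 < N :=
        ⟨s.sup Prod.fst + 1, fun p hp => Nat.lt_succ_of_le (Finset.le_sup (f := Prod.fst) hp)⟩
      have hev : ∀ᶠ m in atTop, ∀ p ∈ s, p.2 < m ∧ a p.2 m < η N ∧ a m p.2 < η p.1 := by
        rw [eventually_all_finset]
        exact fun p hp => (eventually_gt_atTop p.2).and <|
          ((hrow p.2).eventually_lt_const (hη N)).and ((hcol p.2).eventually_lt_const (hs p hp))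
      obtain ⟨m, hm, hbm⟩ := (hev.and (hb.eventually_lt_const (hη N))).exists
      exact ⟨(N, m), hbm, fun p hp => ⟨⟨hN p hp, (hm p hp).1⟩, (hm p hp).2⟩⟩
  have hpos : StrictMono fun n => (p n).1 := fun m n hmn => (hp m n hmn).1.1
  refine ⟨fun n => (p n).2, fun m n hmn => (hp m n hmn).1.2, fun i j hij => ?_⟩
  refine le_trans ?_ (hanti (hpos.le_apply (x := j)))
  rcases hij.lt_or_gt with h | h
  · exact (hp i j h).2.1.le
  · exact (hp j i h).2.2.le

section AlmostBiorthogonal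

variable {𝕜 X Y : Type*} [RCLike 𝕜] [NormedAddCommGroup X] [NormedSpace 𝕜 X]
  [NormedAddCommGroup Y] [NormedSpace 𝕜 Y]

/-- The matrix `g i (y j)` is `c` times the identity matrix up to an error which, throughout
column `j`, is at most `η j`. -/
def IsAlmostBiorthogonal (g : ℕ → StrongDual 𝕜 Y) (y : ℕ → Y) (c : 𝕜) (η : ℕ → ℝ) : Prop :=
  ∀ i j, ‖(if i = j then c else 0) - g i (y j)‖ ≤ η j

theorem IsAlmostBiorthogonal.even_sub_odd {g : ℕ → StrongDual 𝕜 Y} {y : ℕ → Y} {c : 𝕜}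
    {η : ℕ → ℝ} (h : IsAlmostBiorthogonal g y c η) (hη : Antitone η) :
    IsAlmostBiorthogonal (fun i => (2⁻¹ : 𝕜) • (g (2 * i) - g (2 * i + 1)))
      (fun j => y (2 * j) - y (2 * j + 1)) c fun j => 2 * η j := fun i j => by
  let e : ℕ → ℕ → 𝕜 := fun m n => (if m = n then c else 0) - g m (y n)
  have he : ∀ m n, j ≤ n → ‖e m n‖ ≤ η j := fun m n hn => (h m n).trans (hη hn)
  have hsplit : (if i = j then c else 0) - ((2⁻¹ : 𝕜) • (g (2 * i) - g (2 * i + 1)))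
        (y (2 * j) - y (2 * j + 1)) =
      2⁻¹ * ((e (2 * i) (2 * j) - e (2 * i) (2 * j + 1)) -
        (e (2 * i + 1) (2 * j) - e (2 * i + 1) (2 * j + 1))) := by
    have hne : 2 * i ≠ 2 * j + 1 := by omega
    have hne' : 2 * i + 1 ≠ 2 * j := by omega
    simp only [e, smul_apply, sub_apply, map_sub, smul_eq_mul, hne, hne', if_false,
      Nat.mul_right_inj two_ne_zero, Nat.add_right_cancel_iff]
    split_ifs <;> field_simp <;> ring
  rw [hsplit, norm_mul, norm_inv, RCLike.norm_ofNat]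
  have hrow := norm_sub_le (e (2 * i) (2 * j)) (e (2 * i) (2 * j + 1))
  have hrow' := norm_sub_le (e (2 * i + 1) (2 * j)) (e (2 * i + 1) (2 * j + 1))
  linarith [norm_sub_le (e (2 * i) (2 * j) - e (2 * i) (2 * j + 1))
      (e (2 * i + 1) (2 * j) - e (2 * i + 1) (2 * j + 1)),
    he (2 * i) (2 * j) (by omega), he (2 * i) (2 * j + 1) (by omega),
    he (2 * i + 1) (2 * j) (by omega), he (2 * i + 1) (2 * j + 1) (by omega)]

theorem exists_dual_apply_eq_of_le_norm (y : Y) {δ : ℝ} (hδ : 0 ≤ δ) (hy : δ ≤ ‖y‖) :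
    ∃ g : StrongDual 𝕜 Y, ‖g‖ ≤ 1 ∧ g y = δ := by
  obtain ⟨g, hg, hgy⟩ := exists_dual_vector'' 𝕜 y
  rcases (norm_nonneg y).eq_or_lt with h0 | hpos
  · exact ⟨g, hg, by rw [hgy, ← h0, hδ.antisymm (hy.trans h0.ge)]⟩
  refine ⟨((δ / ‖y‖ : ℝ) : 𝕜) • g, ?_, ?_⟩
  · rw [norm_smul, RCLike.norm_of_nonneg (by positivity)]
    exact mul_le_one₀ ((div_le_one hpos).2 hy) (norm_nonneg g) hg
  · rw [smul_apply, hgy, smul_eq_mul, ← RCLike.ofReal_mul,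
      div_mul_cancel₀ δ hpos.ne']

theorem exists_strictMono_isAlmostBiorthogonal (hY : DualBallWeakStarSeqCompact 𝕜 Y)
    {y : ℕ → Y} (hy : ∀ φ : StrongDual 𝕜 Y, Tendsto (fun n => φ (y n)) atTop (𝓝 0)) {δ : ℝ}
    (hδ : 0 ≤ δ) (hδy : ∀ n, δ ≤ ‖y n‖) {η : ℕ → ℝ} (hη : ∀ n, 0 < η n) (hanti : Antitone η) :
    ∃ (φ : ℕ → ℕ) (g : ℕ → StrongDual 𝕜 Y) (γ : StrongDual 𝕜 Y), StrictMono φ ∧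
      (∀ n, ‖g n‖ ≤ 1) ∧ (∀ z, Tendsto (fun n => g n z) atTop (𝓝 (γ z))) ∧
      IsAlmostBiorthogonal g (fun n => y (φ n)) (δ : 𝕜) η := by
  choose g hg hgy using fun n => exists_dual_apply_eq_of_le_norm (𝕜 := 𝕜) (y n) hδ (hδy n)
  obtain ⟨γ, -, ψ, hψ, hγ⟩ := hY (x := fun n => StrongDual.toWeakDual (g n)) hg
  have hlim : ∀ z, Tendsto (fun n => g (ψ n) z) atTop (𝓝 (γ z)) := fun z =>
    ((WeakDual.eval_continuous z).tendsto γ).comp hγ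
  have hnull : ∀ θ : StrongDual 𝕜 Y, Tendsto (fun n => ‖θ (y (ψ n))‖) atTop (𝓝 0) := fun θ =>
    tendsto_zero_iff_norm_tendsto_zero.1 ((hy θ).comp hψ.tendsto_atTop)
  obtain ⟨φ, hφ, hoff⟩ := exists_strictMono_offDiag_le hη hanti
    (fun i => hnull (g (ψ i))) (fun j => (hlim (y (ψ j))).norm) (hnull (WeakDual.toStrongDual γ))
  refine ⟨ψ ∘ φ, g ∘ ψ ∘ φ, WeakDual.toStrongDual γ, hψ.comp hφ, fun n => hg _,
    fun z => (hlim z).comp hφ.tendsto_atTop, fun i j => ?_⟩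
  by_cases hij : i = j
  · subst hij
    simpa [hgy] using (hη i).le
  · simpa [hij] using hoff i j hij

theorem exists_factorization_of_isAlmostBiorthogonal [CompleteSpace X] (T : X →L[𝕜] Y)
    {u : ℕ → StrongDual 𝕜 Y} {w : ℕ → X} {c : 𝕜} {a : ℕ → ℝ} {ε M N : ℝ}
    (hu : ∀ n, ‖u n‖ ≤ N) (hu0 : ∀ z, Tendsto (fun n => u n z) atTop (𝓝 0))
    (hw : HasWUCBound 𝕜 w M) (huw : IsAlmostBiorthogonal u (fun j => T (w j)) c a)
    (ha : HasSum a ε) (hε : ε < ‖c‖) :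
    ∃ (U : Y →L[𝕜] CZero 𝕜) (V : CZero 𝕜 →L[𝕜] X),
      U ∘L T ∘L V = ContinuousLinearMap.id 𝕜 (CZero 𝕜) ∧ ‖U‖ ≤ (‖c‖ - ε)⁻¹ * N ∧ ‖V‖ ≤ M := by
  obtain ⟨U, hU, hUu⟩ := CZero.exists_clm_coord_eq hu hu0
  obtain ⟨V, hV, hVw⟩ := CZero.exists_clm_apply_single_eq hw
  have hnear : ‖c • (1 : CZero 𝕜 →L[𝕜] CZero 𝕜) - U ∘L T ∘L V‖ ≤ ε := by
    refine CZero.opNorm_le_of_norm_apply_single_le ha fun j =>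
      (zeroAtInfty_norm_le_iff ((norm_nonneg _).trans (huw 0 j))).2 fun i => ?_
    simpa [CZero.single_apply, hUu, hVw] using huw i j
  obtain ⟨R, hR, hRc⟩ := exists_leftInverse_norm_le_of_norm_smul_one_sub_le
    (A := CZero 𝕜 →L[𝕜] CZero 𝕜) hnear hε
  refine ⟨R ∘L U, V, hR, (R.opNorm_comp_le U).trans ?_, hV⟩
  gcongr

theorem exists_factorization_of_hasWUCBound [CompleteSpace X]
    (hY : DualBallWeakStarSeqCompact 𝕜 Y) (T : X →L[𝕜] Y) {x : ℕ → X} {M δ ε : ℝ}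
    (hx : HasWUCBound 𝕜 x M) (hδ : ∀ n, δ ≤ ‖T (x n)‖) (hε : 0 < ε) (hεδ : ε < δ) :
    ∃ (U : Y →L[𝕜] CZero 𝕜) (V : CZero 𝕜 →L[𝕜] X),
      U ∘L T ∘L V = ContinuousLinearMap.id 𝕜 (CZero 𝕜) ∧ ‖U‖ ≤ (δ - ε)⁻¹ ∧ ‖V‖ ≤ M := by
  have hδ0 : 0 ≤ δ := (hε.trans hεδ).le
  let η : ℕ → ℝ := fun n => ε / 2 / 2 / 2 ^ n
  have hη : ∀ n, 0 < η n := fun n => by positivity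
  have hanti : Antitone η := fun m n hmn => by
    simp only [η]
    gcongr
    norm_num
  have hsum : HasSum (fun n => 2 * η n) ε := by
    simpa [mul_div_cancel₀] using (hasSum_geometric_two' (ε / 2)).mul_left 2
  have hnull : ∀ φ : StrongDual 𝕜 Y, Tendsto (fun n => φ (T (x n))) atTop (𝓝 0) := fun φ =>
    Nat.cofinite_eq_atTop ▸ hx.tendsto_apply_zero (φ ∘L T)
  obtain ⟨φ, g, γ, hφ, hg, hgγ, hbi⟩ :=
    exists_strictMono_isAlmostBiorthogonal hY hnull hδ0 hδ hη hanti
  -- The functionals `g n - γ` are weak* null as well, but their norms are only bounded by `2`.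
  have hu : ∀ n, ‖(2⁻¹ : 𝕜) • (g (2 * n) - g (2 * n + 1))‖ ≤ 1 := fun n => by
    rw [norm_smul, norm_inv, RCLike.norm_ofNat]
    linarith [norm_sub_le (g (2 * n)) (g (2 * n + 1)), hg (2 * n), hg (2 * n + 1)]
  have hu0 : ∀ z, Tendsto (fun n => ((2⁻¹ : 𝕜) • (g (2 * n) - g (2 * n + 1))) z) atTop (𝓝 0) :=
    fun z => by
      have heven : Tendsto (fun n : ℕ => 2 * n) atTop atTop := tendsto_id.const_mul_atTop' two_pos
      simpa using (((hgγ z).comp heven).sub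
        ((hgγ z).comp ((tendsto_add_atTop_nat 1).comp heven))).const_mul (2⁻¹ : 𝕜)
  have hbi' := hbi.even_sub_odd hanti
  simp only [← map_sub] at hbi'
  simpa [abs_of_nonneg hδ0] using exists_factorization_of_isAlmostBiorthogonal T hu hu0
    (hx.comp_injective hφ.injective).even_sub_odd hbi' hsum (by simpa [abs_of_nonneg hδ0])

end AlmostBiorthogonal

section Factorization

variable {𝕜 X Y Z : Type*} [RCLike 𝕜] [NormedAddCommGroup X] [NormedSpace 𝕜 X]
  [NormedAddCommGroup Y] [NormedSpace 𝕜 Y] [NormedAddCommGroup Z] [NormedSpace 𝕜 Z]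

theorem norm_mul_norm_pos_of_comp_comp_eq_id [Nontrivial Z] {U : Y →L[𝕜] Z} {T : X →L[𝕜] Y}
    {V : Z →L[𝕜] X} (h : U ∘L T ∘L V = ContinuousLinearMap.id 𝕜 Z) : 0 < ‖U‖ * ‖V‖ := by
  have hid : ContinuousLinearMap.id 𝕜 Z ≠ 0 := one_ne_zero
  refine mul_pos (norm_pos_iff.2 ?_) (norm_pos_iff.2 ?_) <;> rintro rfl <;> simp [hid.symm] at h

theorem exists_hasWUCBound_of_factorization {U : Y →L[𝕜] CZero 𝕜} {T : X →L[𝕜] Y}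
    {V : CZero 𝕜 →L[𝕜] X} (h : U ∘L T ∘L V = ContinuousLinearMap.id 𝕜 (CZero 𝕜)) :
    ∃ x : ℕ → X, HasWUCBound 𝕜 x 1 ∧ ∀ n, 1 / (‖U‖ * ‖V‖) ≤ ‖T (x n)‖ := by
  have hpos := norm_mul_norm_pos_of_comp_comp_eq_id h
  have hV : 0 < ‖V‖ := pos_of_mul_pos_right hpos (norm_nonneg U)
  have hVinv : ‖(‖V‖⁻¹ : 𝕜)‖ = ‖V‖⁻¹ := by rw [norm_inv, RCLike.norm_ofReal, abs_of_pos hV]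
  refine ⟨fun n => (‖V‖⁻¹ : 𝕜) • V (CZero.single 𝕜 n), ?_, fun n => ?_⟩
  · simpa only [hVinv, mul_one, inv_mul_cancel₀ hV.ne'] using
      (CZero.hasWUCBound_single.map V).const_smul (‖V‖⁻¹ : 𝕜)
  · have hn : 1 ≤ ‖U‖ * ‖T (V (CZero.single 𝕜 n))‖ :=
      calc 1 = ‖CZero.single 𝕜 n‖ := (CZero.norm_single n).symm
        _ = ‖U (T (V (CZero.single 𝕜 n)))‖ :=
          congrArg norm (DFunLike.congr_fun h (CZero.single 𝕜 n)).symm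
        _ ≤ ‖U‖ * ‖T (V (CZero.single 𝕜 n))‖ := U.le_opNorm _
    rw [map_smul, norm_smul, hVinv, div_le_iff₀ hpos]
    calc 1 ≤ ‖U‖ * ‖T (V (CZero.single 𝕜 n))‖ := hn
      _ = ‖V‖⁻¹ * ‖T (V (CZero.single 𝕜 n))‖ * (‖U‖ * ‖V‖) := by field_simp

theorem mainTheorem2_general [CompleteSpace X] (hY : DualBallWeakStarSeqCompact 𝕜 Y)
    (T : X →L[𝕜] Y) {C : ℝ} (hC : 0 < C) :
    (∃ x : ℕ → X, HasWUCBound 𝕜 x 1 ∧ 1 / C < ⨅ n, ‖T (x n)‖) ↔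
      ∃ (U : Y →L[𝕜] CZero 𝕜) (V : CZero 𝕜 →L[𝕜] X),
        U ∘L T ∘L V = ContinuousLinearMap.id 𝕜 (CZero 𝕜) ∧ ‖U‖ * ‖V‖ < C := by
  constructor
  · rintro ⟨x, hx, hT⟩
    obtain ⟨ρ, hCρ, hρ⟩ := exists_between hT
    have hle : ∀ n, ⨅ n, ‖T (x n)‖ ≤ ‖T (x n)‖ :=
      ciInf_le ⟨0, Set.forall_mem_range.2 fun _ => norm_nonneg _⟩
    have hC' : 0 < 1 / C := one_div_pos.2 hC
    obtain ⟨U, V, hUV, hU, hV⟩ := exists_factorization_of_hasWUCBound hY T hx hle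
      (sub_pos.2 hρ) (sub_lt_self _ (hC'.trans hCρ))
    refine ⟨U, V, hUV, ?_⟩
    calc ‖U‖ * ‖V‖ ≤ ‖U‖ := mul_le_of_le_one_right (norm_nonneg U) hV
      _ ≤ ρ⁻¹ := by rwa [sub_sub_cancel] at hU
      _ < C := inv_lt_of_inv_lt₀ hC (by rwa [← one_div])
  · rintro ⟨U, V, hUV, hlt⟩
    obtain ⟨x, hx, hT⟩ := exists_hasWUCBound_of_factorization hUV
    exact ⟨x, hx, (one_div_lt_one_div_of_lt (norm_mul_norm_pos_of_comp_comp_eq_id hUV) hlt).trans_le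
      (le_ciInf hT)⟩

end Factorization

theorem mainTheorem2 {𝕜 : Type*} [RCLike 𝕜]
    {K : Type*} [TopologicalSpace K] [LocallyCompactSpace K] [T2Space K]
    {Y : Type*} [NormedAddCommGroup Y] [NormedSpace 𝕜 Y] [CompleteSpace Y]
    (hY : DualBallWeakStarSeqCompact 𝕜 Y)
    (T : C₀(K, 𝕜) →L[𝕜] Y) (C : ℝ) (hC : 0 < C) :
    (∃ f : ℕ → C₀(K, 𝕜),
        (⨆ k : K, ∑' n : ℕ, ‖f n k‖ₑ) ≤ 1 ∧ 1 / C < ⨅ n : ℕ, ‖T (f n)‖) ↔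
      ∃ (U : Y →L[𝕜] CZero 𝕜) (V : CZero 𝕜 →L[𝕜] C₀(K, 𝕜)),
        U ∘L T ∘L V = ContinuousLinearMap.id 𝕜 (CZero 𝕜) ∧ ‖U‖ * ‖V‖ < C := by
  simpa only [hasWUCBound_zeroAtInfty_iff_iSup_tsum_enorm_le zero_le_one, ENNReal.ofReal_one]
    using mainTheorem2_general hY T hC
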